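/- Consider $n$ processes with unique identifiers (a set $\Pi$, $|\Pi|=n$) operating in synchronous rounds $r=1,2,\dots$. In round $r$ every process sends a message to every process, and the message from $p$ to $q$ is received iff $(p\to q)\in\mathcal G^r$, where the communication graph $\mathcal G^r$ is a digraph on $\Pi$ containing all self-loops; then every process makes a deterministic state transition. A message adversary is a set of (admissible) infinite sequences $(\mathcal G^r)_{r\ge1}$. An algorithm solves consensus under it if in every execution with an admissible sequence, for all inputs from a fixed set of at least two values, every process eventually and irrevocably decides a value (termination), all decided values are equal (agreement), and every decided value is the input of some process (validity). A root component of a graph is the (non-empty) vertex set of a strongly connected component that has no incoming edge from outside; a graph is rooted if it has exactly one root component, and a non-empty sequence of graphs is $R$-rooted if all its graphs are rooted with root component $R$. Let $\lozenge\mathtt{STABLE}_D(x)$ be the set of all sequences such that (i) every $\mathcal G^r$ is rooted; (ii) for some $R\subseteq\Pi$, some at least $x$ consecutive rounds are $R$-rooted; (iii) whenever $D$ consecutive rounds $r_1,\dots,r_1+D-1$ are $R$-rooted for some $R$, then for all $q\in R$ and $p\in\Pi$ there are $q=q_0,q_1,\dots,q_D=p$ with $(q_{i}\to q_{i+1})\in\mathcal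 G^{r_1+i}$ for $0\le i<D$. **Theorem.** Let $1\le x\le D\le n-1$. There is no algorithm, not even a non-uniform one (whose processes may know $n$, hence any bound on $n$, as well as $D$ and $x$), that solves consensus under $\lozenge\mathtt{STABLE}_D(x)$. This holds even if the adversary must in addition guarantee that the first $D$ rounds are $R$-rooted for some $R$ that is not known to the processes a priori, i.e. there is also no such algorithm under the message adversary consisting of those sequences of $\lozenge\mathtt{STABLE}_D(x)$ whose first $D$ rounds are $R$-rooted for some $R\subseteq\Pi$ (which may depend on the sequence). -/

import Mathlib

/-!
# Consensus in directed dynamic networks under eventually stabilizing message adversaries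

`P` is the (finite) set of processes.
-/

namespace DynNet

universe u v w z

/-- A communication graph on the processes `P`: a digraph containing all self-loops.
`G.Adj p q` says that the message from `p` to `q` is delivered. -/
structure CommGraph (P : Type u) extends Digraph P where
  self_loop : ∀ p, Adj p p

/-- An infinite sequence of communication graphs. The term with index `i` is the communication
graph of round `i + 1` (rounds are numbered `1, 2, …`), so the indices in `Set.Ico a b` are the
rounds `a + 1, …, b`. -/
abbrev GraphSeq (P : Type u) := ℕ → CommGraph P

/-- A message adversary, identified with its set of admissible graph sequences. -/
abbrev MessageAdversary (P : Type u) := Set (GraphSeq P)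

section Graphs

variable {P : Type u}

/-- There is a directed path (possibly of length `0`) from `p` to `q`. -/
def CommGraph.Reach (G : CommGraph P) (p q : P) : Prop := Relation.ReflTransGen G.Adj p q

/-- `R` is the vertex set of a strongly connected component of `G`. -/
def CommGraph.IsSCC (G : CommGraph P) (R : Set P) : Prop :=
  ∃ p, R = {q | G.Reach p q ∧ G.Reach q p}

/-- `R` is a root component of `G`: the vertex set of a strongly connected component without
incoming edges from outside. -/
def CommGraph.IsRootComponent (G : CommGraph P) (R : Set P) : Prop :=
  R.Nonempty ∧ G.IsSCC R ∧ ∀ p, ∀ q ∈ R, G.Adj p q → p ∈ R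

/-- `G` is rooted, and its single root component is `R`, i.e. `Root(G) = R`. -/
def CommGraph.HasRoot (G : CommGraph P) (R : Set P) : Prop :=
  G.IsRootComponent R ∧ ∀ R', G.IsRootComponent R' → R' = R

/-- `G` is rooted: it has a single root component. -/
def CommGraph.Rooted (G : CommGraph P) : Prop := ∃ R, G.HasRoot R

/-- The graph with self-loops only. -/
def CommGraph.loops (P : Type u) : CommGraph P where
  Adj p q := p = q
  self_loop _ := rfl

/-- The compound graph `G ∘ G'`. -/
def CommGraph.comp (G G' : CommGraph P) : CommGraph P where
  Adj p q := ∃ p', G.Adj p p' ∧ G'.Adj p' q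
  self_loop p := ⟨p, G.self_loop p, G'.self_loop p⟩

/-- The compound of the `k` graphs of rounds `a + 1, …, a + k` (just the self-loops, the neutral
element of the compound, for `k = 0`). -/
def GraphSeq.compound (σ : GraphSeq P) (a : ℕ) : ℕ → CommGraph P
  | 0 => CommGraph.loops P
  | k + 1 => (GraphSeq.compound σ a k).comp (σ (a + k))

/-- The causal past of `p` from the end of round `b` down to the end of round `a`, for `a ≤ b`:
the in-neighbourhood of `p` in the compound graph of rounds `a + 1, …, b`; it is `{p}` when
`a = b`. -/
def causalPast (σ : GraphSeq P) (p : P) (a b : ℕ) : Set P :=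
  {q | (GraphSeq.compound σ a (b - a)).Adj q p}

/-- The (non-empty) part of `σ` with indices in `I` is `R`-rooted: all its graphs are rooted with
the same root component `R`. -/
def RootedOn (σ : GraphSeq P) (I : Set ℕ) (R : Set P) : Prop :=
  I.Nonempty ∧ ∀ i ∈ I, (σ i).HasRoot R

/-- `DIAM(D)`: after any `D` consecutive `R`-rooted rounds, every process has heard from every
member of `R`. -/
def DIAM (P : Type u) (D : ℕ) : MessageAdversary P :=
  {σ | ∀ (a : ℕ) (R : Set P), RootedOn σ (Set.Ico a (a + D)) R →
    ∀ p, R ⊆ causalPast σ p a (a + D)}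

/-- `◇STABILITY(x)`: for some `R` there are at least `x` consecutive `R`-rooted rounds. -/
def eventualSTABILITY (P : Type u) (x : ℕ) : MessageAdversary P :=
  {σ | ∃ (R : Set P) (a k : ℕ), x ≤ k ∧ RootedOn σ (Set.Ico a (a + k)) R}

/-- `ROOTED`: every communication graph is rooted. -/
def ROOTED (P : Type u) : MessageAdversary P := {σ | ∀ i, (σ i).Rooted}

/-- The short-lived eventually stabilizing message adversary `◇STABLE_D(x)`. -/
def eventualSTABLE (P : Type u) (D x : ℕ) : MessageAdversary P :=
  ROOTED P ∩ eventualSTABILITY P x ∩ DIAM P D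

/-- The sequences whose first `D` rounds are `R`-rooted for some set `R`, which may be different
for different sequences (so it is not known a priori). -/
def initiallyRooted (P : Type u) (D : ℕ) : MessageAdversary P :=
  {σ | ∃ R : Set P, RootedOn σ (Set.Ico 0 D) R}

end Graphs

/-- A deterministic synchronous message passing algorithm for the process set `P` with input and
output values in `V`. Each process has its own state machine, so the behaviour may depend on the
identifier of the process, on all of `P` (in particular on the exact number of processes and on
every bound on it), and on every other parameter that is fixed in advance. -/
structure Algorithm (P : Type u) (V : Type v) where
  /-- local states -/
  State : Type w
  /-- messages -/
  Msg : Type z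
  /-- initial state of a process with a given input -/
  init : P → V → State
  /-- `send p s q` is the message that `p` in state `s` sends to `q` -/
  send : P → State → P → Msg
  /-- state transition of a process on the received messages (`none`: nothing was received) -/
  step : P → State → (P → Option Msg) → State
  /-- the content of the output variable (`none`: not yet decided) -/
  output : P → State → Option V

section Consensus

variable {P : Type u} {V : Type v}

open Classical in
/-- The configuration at the end of the round with communication graph `G`, started in `C`. -/
noncomputable def Algorithm.next (A : Algorithm.{u, v, w, z} P V) (G : CommGraph P)
    (C : P → A.State) : P → A.State :=
  fun p => A.step p (C p) (fun q => if G.Adj q p then some (A.send q (C q) p) else none)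

/-- The configuration at the end of round `r` (the initial one for `r = 0`) of the execution with
inputs `x` and graph sequence `σ`. -/
noncomputable def Algorithm.config (A : Algorithm.{u, v, w, z} P V) (x : P → V) (σ : GraphSeq P) :
    ℕ → P → A.State
  | 0 => fun p => A.init p (x p)
  | r + 1 => A.next (σ r) (A.config x σ r)

/-- The value of the output variable of `p` at the end of round `r`. -/
noncomputable def Algorithm.decision (A : Algorithm.{u, v, w, z} P V) (x : P → V) (σ : GraphSeq P)
    (r : ℕ) (p : P) : Option V :=
  A.output p (A.config x σ r p)

/-- `A` solves consensus under the message adversary `MA`: in every admissible execution, for all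
inputs, decisions are irrevocable and termination, agreement and validity hold. -/
structure Algorithm.SolvesConsensus (A : Algorithm.{u, v, w, z} P V) (MA : MessageAdversary P) :
    Prop where
  irrevocable : ∀ (x : P → V), ∀ σ ∈ MA, ∀ (p : P) (r : ℕ) (y : V),
    A.decision x σ r p = some y → A.decision x σ (r + 1) p = some y
  termination : ∀ (x : P → V), ∀ σ ∈ MA, ∀ p : P, ∃ (r : ℕ) (y : V),
    A.decision x σ r p = some y
  agreement : ∀ (x : P → V), ∀ σ ∈ MA, ∀ (p q : P) (r s : ℕ) (y y' : V),
    A.decision x σ r p = some y → A.decision x σ s q = some y' → y = y'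
  validity : ∀ (x : P → V), ∀ σ ∈ MA, ∀ (p : P) (r : ℕ) (y : V),
    A.decision x σ r p = some y → ∃ q, x q = y

end Consensus

end DynNet

/-! Consensus already fails under a small subadversary, `ringThenBroadcast`. For `D` rounds, `D + 1`
processes form a directed ring, closed or with one edge missing, and all others hear everybody;
afterwards every graph is complete or leaves one process deaf. The initial rounds supply the
required stability, and the later graphs are arbitrary, so no further stability helps the processes
(`ringThenBroadcast_subset`). Cutting the edge into `f k` makes `f k` the only root, and if it then
stays deaf it must decide its own input. The last process of the line, `f (k + D)`, cannot tell the
line from the closed ring within `D` rounds, and may be deaf from then on. Hence, if the first `D`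
rounds always fixed the decision, the closed ring would decide the input of every `f k` at once,
which is absurd when inputs differ (`exists_bivalent_initial`). Bivalence then survives each further
round (`Bivalent.exists_succ`): a deaf round and a complete one differ only in what one process
hears, and another process that is deaf thereafter never learns of it. The limit of these prefixes
is admissible, yet no process can decide in it. -/

namespace DynNet

/-! ### Root components and compounds of rounds. -/

section Graphs

variable {P : Type*}

/-- A nonempty set without incoming edges that reaches every process is the only root component. -/
theorem CommGraph.hasRoot_of_reach {G : CommGraph P} {R : Set P} (hne : R.Nonempty)
    (hreach : ∀ q ∈ R, ∀ p, G.Reach q p) (hin : ∀ p, ∀ q ∈ R, G.Adj p q → p ∈ R) :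
    G.HasRoot R := by
  have back : ∀ {S : Set P}, (∀ p, ∀ q ∈ S, G.Adj p q → p ∈ S) →
      ∀ {p q}, G.Reach p q → q ∈ S → p ∈ S := by
    intro S hS p q hpq hq
    induction hpq using Relation.ReflTransGen.head_induction_on with
    | refl => exact hq
    | head h _ ih => exact hS _ _ ih h
  obtain ⟨q, hq⟩ := hne
  refine ⟨⟨⟨q, hq⟩, ⟨q, ?_⟩, hin⟩, ?_⟩
  · ext p
    exact ⟨fun hp => ⟨hreach q hq p, hreach p hp q⟩, fun hp => back hin hp.2 hq⟩
  · rintro R' ⟨⟨p, hp⟩, ⟨p', hR'⟩, hin'⟩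
    have hsub : R ⊆ R' := fun s hs => back hin' (hreach s hs p) hp
    refine Set.Subset.antisymm (fun s hs => ?_) hsub
    have h1 := hsub hq
    rw [hR'] at hs h1
    exact back hin (hs.2.trans h1.1) hq

theorem CommGraph.HasRoot.unique {G : CommGraph P} {R R' : Set P} (h : G.HasRoot R)
    (h' : G.HasRoot R') : R = R' :=
  h'.2 R h.1

/-- A sequence of processes along which messages are delivered yields an edge of the compound. -/
theorem GraphSeq.compound_adj_of_walk (σ : GraphSeq P) (a : ℕ) (w : ℕ → P) :
    ∀ k, (∀ j < k, (σ (a + j)).Adj (w j) (w (j + 1))) →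
      (GraphSeq.compound σ a k).Adj (w 0) (w k)
  | 0, _ => rfl
  | k + 1, h =>
    ⟨w k, GraphSeq.compound_adj_of_walk σ a w k fun j hj => h j (by omega), h k (by omega)⟩

/-- An edge in some round of a window is an edge of the compound of that window. -/
theorem GraphSeq.compound_adj_of_adj (σ : GraphSeq P) {a i k : ℕ} {q p : P} (hi : i < k)
    (h : (σ (a + i)).Adj q p) : (GraphSeq.compound σ a k).Adj q p := by
  have := GraphSeq.compound_adj_of_walk σ a (fun j => if j ≤ i then q else p) k fun j hj => by
    rcases lt_trichotomy j i with hji | rfl | hji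
    · simpa [hji.le, Nat.succ_le_of_lt hji] using (σ (a + j)).self_loop q
    · simpa using h
    · simpa [hji.not_ge, (hji.trans (Nat.lt_succ_self j)).not_ge] using (σ (a + j)).self_loop p
  simpa [hi.not_ge] using this

/-! ### Graphs whose root members reach everybody in one round. -/

/-- The complete communication graph. -/
def CommGraph.complete (P : Type*) : CommGraph P where
  Adj _ _ := True
  self_loop _ := trivial

/-- The communication graph in which `p` hears only itself and everyone else hears everyone. -/
def CommGraph.deaf (p : P) : CommGraph P where
  Adj a b := b = p → a = p
  self_loop _ := id

theorem CommGraph.hasRoot_complete [Nonempty P] : (CommGraph.complete P).HasRoot Set.univ :=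
  CommGraph.hasRoot_of_reach Set.univ_nonempty
    (fun _ _ _ => Relation.ReflTransGen.single trivial) fun _ _ _ _ => trivial

theorem CommGraph.hasRoot_deaf (p : P) : (CommGraph.deaf p).HasRoot {p} := by
  refine CommGraph.hasRoot_of_reach (Set.singleton_nonempty p) ?_ ?_
  · rintro q rfl r
    exact Relation.ReflTransGen.single fun _ => rfl
  · rintro r q rfl h
    exact h rfl

/-- The graphs in which either nobody or exactly one process is shielded from the others. -/
def broadcastGraphs (P : Type*) : Set (CommGraph P) :=
  insert (CommGraph.complete P) (Set.range CommGraph.deaf)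

theorem exists_hasRoot_of_mem_broadcastGraphs [Nonempty P] {G : CommGraph P}
    (hG : G ∈ broadcastGraphs P) : ∃ R, G.HasRoot R ∧ ∀ q ∈ R, ∀ p, G.Adj q p := by
  rcases hG with rfl | ⟨p, rfl⟩
  · exact ⟨_, CommGraph.hasRoot_complete, fun _ _ _ => trivial⟩
  · exact ⟨_, CommGraph.hasRoot_deaf p, fun q hq _ _ => hq⟩

/-! ### Closed and cut rings. -/

/-- The directed ring through the `f i`, without the edges into the `f i` with `i ∈ c`; the
processes outside of the ring hear everyone. -/
def CommGraph.ring {D : ℕ} (f : ZMod (D + 1) → P) (c : Set (ZMod (D + 1))) : CommGraph P where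
  Adj q p := q = p ∨ p ∉ Set.range f ∨ ∃ i, i + 1 ∉ c ∧ q = f i ∧ p = f (i + 1)
  self_loop _ := Or.inl rfl

variable {D : ℕ} {f : ZMod (D + 1) → P}

theorem _root_.ZMod.natCast_succ_ne_zero {m : ℕ} (h : m < D) : ((m : ZMod (D + 1)) + 1) ≠ 0 := by
  intro h0
  have h1 : ((m + 1 : ℕ) : ZMod (D + 1)) = 0 := by exact_mod_cast h0
  rw [ZMod.natCast_eq_zero_iff] at h1
  exact absurd (Nat.le_of_dvd (by omega) h1) (by omega)

/-- In at most `D` rounds, information goes from `f i` around the ring to everybody, unless it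
has to pass a missing edge. -/
theorem compound_ring_adj {σ : GraphSeq P} {c : Set (ZMod (D + 1))} (hD : 1 ≤ D)
    (hσ : ∀ j < D, σ j = CommGraph.ring f c) (i : ZMod (D + 1))
    (hc : ∀ m : ℕ, m < D → i + m + 1 ∉ c) (p : P) : (GraphSeq.compound σ 0 D).Adj (f i) p := by
  by_cases hp : p ∈ Set.range f
  · obtain ⟨j, rfl⟩ := hp
    have hm : (j - i).val ≤ D := Nat.lt_succ_iff.mp (ZMod.val_lt (j - i))
    have := GraphSeq.compound_adj_of_walk σ 0
      (fun t => f (i + (min t (j - i).val : ℕ))) D fun t ht => by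
        rw [zero_add, hσ t ht]
        rcases lt_or_ge t (j - i).val with h | h
        · refine Or.inr (Or.inr ⟨i + t, hc t ht, ?_, ?_⟩)
          · simp only [min_eq_left h.le]
          · simp only [min_eq_left (Nat.succ_le_of_lt h)]
            push_cast
            rw [add_assoc]
        · exact Or.inl (by simp only [min_eq_right h, min_eq_right (h.trans (Nat.le_succ t))])
    simpa only [Nat.zero_min, Nat.cast_zero, add_zero, min_eq_right hm, ZMod.natCast_val,
      ZMod.cast_id', id, add_sub_cancel] using this
  · refine GraphSeq.compound_adj_of_adj σ (i := 0) (by omega) ?_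
    rw [hσ _ (by omega)]
    exact Or.inr (Or.inl hp)

/-- For a constant sequence, the bound on information flow also yields the reachability needed for
rootedness. -/
theorem reach_of_compound_adj {G : CommGraph P} (k : ℕ) :
    ∀ {q p : P}, (GraphSeq.compound (fun _ => G) 0 k).Adj q p → G.Reach q p := by
  induction k with
  | zero =>
    rintro q p (rfl : q = p)
    exact Relation.ReflTransGen.refl
  | succ k ih =>
    rintro q p ⟨r, hqr, hrp⟩
    exact (ih hqr).tail hrp

theorem hasRoot_ring_empty (hD : 1 ≤ D) : (CommGraph.ring f ∅).HasRoot (Set.range f) := by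
  refine CommGraph.hasRoot_of_reach (Set.range_nonempty f) ?_ ?_
  · rintro _ ⟨i, rfl⟩ p
    exact reach_of_compound_adj D
      (compound_ring_adj (c := ∅) hD (fun _ _ => rfl) i (fun _ _ => Set.notMem_empty _) p)
  · rintro p q hq (rfl | h | ⟨i, -, rfl, -⟩)
    · exact hq
    · exact absurd hq h
    · exact ⟨i, rfl⟩

/-- Modulo `D + 1`, the index returns to `k` only after `D + 1` steps, so a walk of at most `D`
edges from `f k` never needs the missing edge. -/
theorem succ_notMem_cut (k : ZMod (D + 1)) (m : ℕ) (hm : m < D) :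
    k + m + 1 ∉ ({k} : Set (ZMod (D + 1))) := by
  rw [Set.mem_singleton_iff, add_assoc, add_eq_left]
  exact ZMod.natCast_succ_ne_zero hm

theorem hasRoot_ring_singleton (hD : 1 ≤ D) (hf : Function.Injective f) (k : ZMod (D + 1)) :
    (CommGraph.ring f {k}).HasRoot {f k} := by
  refine CommGraph.hasRoot_of_reach (Set.singleton_nonempty _) ?_ ?_
  · rintro _ rfl p
    exact reach_of_compound_adj D
      (compound_ring_adj (c := {k}) hD (fun _ _ => rfl) k (succ_notMem_cut k) p)
  · rintro p _ rfl (rfl | h | ⟨i, hi, rfl, h⟩)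
    · rfl
    · exact absurd ⟨k, rfl⟩ h
    · exact absurd (hf h).symm hi

/-! ### The subadversary and its closure under splicing. -/

/-- The sequences that begin with `D` rounds of the ring, with at most one edge missing, and go on
with broadcast graphs. -/
def ringThenBroadcast (f : ZMod (D + 1) → P) : MessageAdversary P :=
  {σ | (∃ c : Set (ZMod (D + 1)), (c = ∅ ∨ ∃ k, c = {k}) ∧ ∀ i < D, σ i = CommGraph.ring f c) ∧
    ∀ i, D ≤ i → σ i ∈ broadcastGraphs P}

theorem exists_hasRoot_ring {σ : GraphSeq P} {c : Set (ZMod (D + 1))} (hD : 1 ≤ D)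
    (hf : Function.Injective f) (hc : c = ∅ ∨ ∃ k, c = {k})
    (hσ : ∀ i < D, σ i = CommGraph.ring f c) :
    ∃ R, (CommGraph.ring f c).HasRoot R ∧
      ∀ q ∈ R, ∀ p, (GraphSeq.compound σ 0 D).Adj q p := by
  rcases hc with rfl | ⟨k, rfl⟩
  · refine ⟨_, hasRoot_ring_empty hD, ?_⟩
    rintro _ ⟨i, rfl⟩ p
    exact compound_ring_adj hD hσ i (fun _ _ => Set.notMem_empty _) p
  · refine ⟨_, hasRoot_ring_singleton hD hf k, ?_⟩
    rintro _ rfl p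
    exact compound_ring_adj hD hσ k (succ_notMem_cut k) p

theorem ringThenBroadcast_subset {x : ℕ} (hD : 1 ≤ D) (hxD : x ≤ D) (hf : Function.Injective f) :
    ringThenBroadcast f ⊆ eventualSTABLE P D x ∩ initiallyRooted P D := by
  rintro σ ⟨⟨c, hc, hring⟩, hbc⟩
  have : Nonempty P := ⟨f 0⟩
  obtain ⟨R, hR, hreach⟩ := exists_hasRoot_ring hD hf hc hring
  have hinit : RootedOn σ (Set.Ico 0 D) R :=
    ⟨⟨0, le_rfl, hD⟩, fun i hi => by rw [hring i hi.2]; exact hR⟩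
  refine ⟨⟨⟨fun i => ?_, R, 0, D, hxD, by rwa [zero_add]⟩, fun a R' hR' p q hq => ?_⟩, R, hinit⟩
  · rcases lt_or_ge i D with hi | hi
    · exact ⟨R, hinit.2 i ⟨zero_le, hi⟩⟩
    · obtain ⟨S, hS, -⟩ := exists_hasRoot_of_mem_broadcastGraphs (hbc i hi)
      exact ⟨S, hS⟩
  · change (GraphSeq.compound σ a (a + D - a)).Adj q p
    rw [Nat.add_sub_cancel_left]
    rcases Nat.eq_zero_or_pos a with rfl | ha
    · refine hreach q ?_ p
      rwa [(hinit.2 0 ⟨le_rfl, hD⟩).unique (hR'.2 0 ⟨le_rfl, by omega⟩)]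
    -- A window with `a > 0` ends in a broadcast round, which alone suffices.
    · obtain ⟨S, hS, hadj⟩ := exists_hasRoot_of_mem_broadcastGraphs
        (hbc (a + (D - 1)) (by omega))
      refine GraphSeq.compound_adj_of_adj σ (i := D - 1) (by omega) (hadj q ?_ p)
      rwa [hS.unique (hR'.2 (a + (D - 1)) ⟨by omega, by omega⟩)]

/-- The sequence that follows `σ` for `r` rounds and has the constant graph `G` afterwards. -/
def GraphSeq.splice (σ : GraphSeq P) (r : ℕ) (G : CommGraph P) : GraphSeq P :=
  fun i => if i < r then σ i else G

theorem GraphSeq.splice_of_lt (σ : GraphSeq P) {r i : ℕ} (G : CommGraph P) (h : i < r) :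
    σ.splice r G i = σ i := if_pos h

theorem GraphSeq.splice_of_le (σ : GraphSeq P) {r i : ℕ} (G : CommGraph P) (h : r ≤ i) :
    σ.splice r G i = G := if_neg h.not_gt

theorem splice_mem_ringThenBroadcast {σ : GraphSeq P} (hσ : σ ∈ ringThenBroadcast f) {r : ℕ}
    (hr : D ≤ r) {G : CommGraph P} (hG : G ∈ broadcastGraphs P) :
    σ.splice r G ∈ ringThenBroadcast f := by
  obtain ⟨⟨c, hc, hring⟩, hbc⟩ := hσ
  refine ⟨⟨c, hc, fun i hi => ?_⟩, fun i hi => ?_⟩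
  · rw [σ.splice_of_lt G (hi.trans_le hr), hring i hi]
  · rcases lt_or_ge i r with h | h
    · rw [σ.splice_of_lt G h]; exact hbc i hi
    · rw [σ.splice_of_le G h]; exact hG

theorem ring_splice_mem {c : Set (ZMod (D + 1))} (hc : c = ∅ ∨ ∃ k, c = {k}) {G : CommGraph P}
    (hG : G ∈ broadcastGraphs P) :
    GraphSeq.splice (fun _ => CommGraph.ring f c) D G ∈ ringThenBroadcast f :=
  ⟨⟨c, hc, fun _ hi => GraphSeq.splice_of_lt _ G hi⟩,
    fun _ hi => by rw [GraphSeq.splice_of_le _ G hi]; exact hG⟩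

end Graphs

/-! ### Indistinguishable executions. -/

section Consensus

universe w z

variable {P : Type*} {V : Type*} (A : Algorithm.{_, _, w, z} P V)

/-- If the processes in `U (r + 1)` hear, in both executions, from the same processes, all of them
in `U r`, then the two executions cannot be distinguished by the processes in `U r` at time `r`. -/
theorem Algorithm.config_eq_of_unaffected {x x' : P → V} {σ σ' : GraphSeq P} (U : ℕ → Set P)
    {a b : ℕ} (h0 : ∀ p ∈ U a, A.config x σ a p = A.config x' σ' a p)
    (h : ∀ r, a ≤ r → r < b → ∀ p ∈ U (r + 1), ∀ q,
      ((σ r).Adj q p ↔ (σ' r).Adj q p) ∧ ((σ r).Adj q p → q ∈ U r)) :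
    ∀ r, a ≤ r → r ≤ b → ∀ p ∈ U r, A.config x σ r p = A.config x' σ' r p := by
  intro r har
  induction r, har using Nat.le_induction with
  | base => exact fun _ => h0
  | succ r har ih =>
    intro hrb p hp
    have key := h r har (by omega) p hp
    have ih' := ih (by omega)
    simp only [Algorithm.config, Algorithm.next]
    rw [ih' p ((key p).2 ((σ r).self_loop p))]
    congr 1
    funext q
    by_cases hq : (σ r).Adj q p
    · rw [if_pos hq, if_pos ((key q).1.1 hq), ih' q ((key q).2 hq)]
    · rw [if_neg hq, if_neg (fun h' => hq ((key q).1.2 h'))]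

theorem Algorithm.config_congr {x : P → V} {σ σ' : GraphSeq P} {r : ℕ}
    (h : ∀ i < r, σ i = σ' i) : A.config x σ r = A.config x σ' r := by
  funext p
  exact A.config_eq_of_unaffected (x := x) (x' := x) (σ := σ) (σ' := σ') (fun _ => Set.univ)
    (a := 0) (b := r) (fun _ _ => rfl) (fun i _ hi _ _ q => ⟨by rw [h i hi], fun _ => trivial⟩) r (Nat.zero_le r) le_rfl p trivial

/-- A process that hears only itself cannot distinguish executions in which it was in the same
state. -/
theorem Algorithm.config_splice_deaf_eq {x x' : P → V} {σ σ' : GraphSeq P} {r : ℕ} {p : P}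
    (h : A.config x σ r p = A.config x' σ' r p) (s : ℕ) (hs : r ≤ s) :
    A.config x (σ.splice r (.deaf p)) s p = A.config x' (σ'.splice r (.deaf p)) s p := by
  refine A.config_eq_of_unaffected (fun _ => {p}) (a := r) (b := s) ?_ ?_ s hs le_rfl p rfl
  · rintro _ rfl
    rw [A.config_congr fun i hi => σ.splice_of_lt _ hi,
      A.config_congr fun i hi => σ'.splice_of_lt _ hi, h]
  · rintro i hi - _ rfl q
    rw [σ.splice_of_le _ hi, σ'.splice_of_le _ hi]
    exact ⟨Iff.rfl, fun h => h rfl⟩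

variable {D : ℕ} {f : ZMod (D + 1) → P}

/-- The process at the end of the line does not notice within `D` rounds whether or not the ring
is closed. -/
theorem Algorithm.config_ring_cut_eq (hf : Function.Injective f) (x : P → V) (k : ZMod (D + 1)) :
    A.config x (fun _ => CommGraph.ring f ∅) D (f (k + D)) =
      A.config x (fun _ => CommGraph.ring f {k}) D (f (k + D)) := by
  refine A.config_eq_of_unaffected (x := x) (x' := x) (σ := fun _ => CommGraph.ring f ∅)
    (σ' := fun _ => CommGraph.ring f {k})
    -- The missing edge can affect `f k` in the first round, and its effect advances one process per
    -- round; so after `r` rounds the `f (k + j)` with `r ≤ j ≤ D` are still unaffected.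
    (fun r => {p | ∃ j : ℕ, r ≤ j ∧ j ≤ D ∧ p = f (k + j)}) (a := 0) (b := D) (fun _ _ => rfl) ?_ D (Nat.zero_le D) le_rfl _ ⟨D, le_rfl, le_rfl, rfl⟩
  rintro r - - p ⟨j, hrj, hjD, rfl⟩ q
  obtain ⟨m, rfl⟩ : ∃ m, j = m + 1 := ⟨j - 1, by omega⟩
  have hm : k + ((m + 1 : ℕ) : ZMod (D + 1)) = k + m + 1 := by push_cast; rw [add_assoc]
  constructor
  · refine or_congr_right (or_congr_right (exists_congr fun i => and_congr_left ?_))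
    rintro ⟨-, hi⟩
    rw [← hf hi, hm]
    simp only [Set.mem_empty_iff_false, not_false_eq_true, true_iff]
    exact succ_notMem_cut k m (by omega)
  · rintro (rfl | h | ⟨i, -, rfl, hi⟩)
    · exact ⟨m + 1, by omega, hjD, rfl⟩
    · exact absurd ⟨_, rfl⟩ h
    · refine ⟨m, by omega, by omega, ?_⟩
      rw [add_right_cancel ((hf hi).symm.trans hm)]

/-- At the beginning of the line, nothing is ever heard. -/
theorem Algorithm.config_ring_source_eq (hf : Function.Injective f) {x x' : P → V}
    (k : ZMod (D + 1)) (hx : x (f k) = x' (f k)) (r : ℕ) :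
    A.config x (fun _ => CommGraph.ring f {k}) r (f k) =
      A.config x' (fun _ => CommGraph.ring f {k}) r (f k) := by
  refine A.config_eq_of_unaffected (fun _ => {f k}) (a := 0) (b := r) ?_ ?_ r (Nat.zero_le r)
    le_rfl _ rfl
  · rintro _ rfl
    simp only [Algorithm.config, hx]
  · rintro i - - _ rfl q
    refine ⟨Iff.rfl, ?_⟩
    rintro (h | h | ⟨i, hi, -, h⟩)
    · exact h
    · exact absurd ⟨k, rfl⟩ h
    · exact absurd (hf h).symm hi

/-! ### Decision values and bivalence. -/

/-- `dec x σ` is the common decision value of the execution with inputs `x` and sequence `σ`. -/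
def Algorithm.DecisionFunction (T : MessageAdversary P) (dec : (P → V) → GraphSeq P → V) : Prop :=
  ∀ x, ∀ σ ∈ T, ∀ p, ∃ r, ∀ s, r ≤ s → A.decision x σ s p = some (dec x σ)

variable {A}

theorem Algorithm.SolvesConsensus.mono {T T' : MessageAdversary P} (h : A.SolvesConsensus T')
    (hT : T ⊆ T') : A.SolvesConsensus T where
  irrevocable x σ hσ := h.irrevocable x σ (hT hσ)
  termination x σ hσ := h.termination x σ (hT hσ)
  agreement x σ hσ := h.agreement x σ (hT hσ)
  validity x σ hσ := h.validity x σ (hT hσ)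

theorem Algorithm.SolvesConsensus.exists_decisionFunction [Nonempty P] [Nonempty V]
    {T : MessageAdversary P} (h : A.SolvesConsensus T) : ∃ dec, A.DecisionFunction T dec := by
  have key : ∀ x σ, ∃ v : V, σ ∈ T → ∀ p, ∃ r, ∀ s, r ≤ s → A.decision x σ s p = some v := by
    intro x σ
    by_cases hσ : σ ∈ T
    · obtain ⟨p₀⟩ := ‹Nonempty P›
      obtain ⟨r₀, v, hv⟩ := h.termination x σ hσ p₀
      refine ⟨v, fun _ p => ?_⟩
      obtain ⟨r, y, hy⟩ := h.termination x σ hσ p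
      obtain rfl := h.agreement x σ hσ p p₀ r r₀ y v hy hv
      refine ⟨r, fun s hs => ?_⟩
      induction s, hs using Nat.le_induction with
      | base => exact hy
      | succ s _ ih => exact h.irrevocable x σ hσ p s _ ih
    · exact ⟨Classical.arbitrary V, fun h' => absurd h' hσ⟩
  choose dec hdec using key
  exact ⟨dec, hdec⟩

theorem Algorithm.DecisionFunction.eq_of_config_eq {T : MessageAdversary P}
    {dec : (P → V) → GraphSeq P → V} (h : A.DecisionFunction T dec) {x x' : P → V}
    {σ σ' : GraphSeq P} (hσ : σ ∈ T) (hσ' : σ' ∈ T) (p : P) (r : ℕ)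
    (hc : ∀ s, r ≤ s → A.config x σ s p = A.config x' σ' s p) : dec x σ = dec x' σ' := by
  obtain ⟨r₁, h₁⟩ := h x σ hσ p
  obtain ⟨r₂, h₂⟩ := h x' σ' hσ' p
  have e₁ := h₁ (max r (max r₁ r₂)) (by omega)
  have e₂ := h₂ (max r (max r₁ r₂)) (by omega)
  rw [Algorithm.decision, hc _ (le_max_left _ _)] at e₁
  exact Option.some.inj (e₁.symm.trans e₂)

/-- The first `r` rounds of `σ` do not determine the value of `d` on `T`. -/
def Bivalent (T : MessageAdversary P) (d : GraphSeq P → V) (σ : GraphSeq P) (r : ℕ) : Prop :=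
  ∃ τ ∈ T, ∃ τ' ∈ T, (∀ i < r, τ i = σ i) ∧ (∀ i < r, τ' i = σ i) ∧ d τ ≠ d τ'

theorem eq_of_not_bivalent {T : MessageAdversary P} {d : GraphSeq P → V} {σ τ τ' : GraphSeq P}
    {r : ℕ} (h : ¬ Bivalent T d σ r) (hτ : τ ∈ T) (hτ' : τ' ∈ T) (hi : ∀ i < r, τ i = σ i)
    (hi' : ∀ i < r, τ' i = σ i) : d τ = d τ' := by
  by_contra hne
  exact h ⟨τ, hτ, τ', hτ', hi, hi', hne⟩

theorem deaf_mem_broadcastGraphs (p : P) : CommGraph.deaf p ∈ broadcastGraphs P :=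
  Or.inr ⟨p, rfl⟩

theorem complete_mem_broadcastGraphs : CommGraph.complete P ∈ broadcastGraphs P :=
  Or.inl rfl

/-- Some execution is still bivalent after the initial `D` rounds. -/
theorem exists_bivalent_initial [Nontrivial V] (hD : 1 ≤ D) (hf : Function.Injective f)
    (hA : A.SolvesConsensus (ringThenBroadcast f)) {dec : (P → V) → GraphSeq P → V}
    (hdec : A.DecisionFunction (ringThenBroadcast f) dec) :
    ∃ x, ∃ σ ∈ ringThenBroadcast f, Bivalent (ringThenBroadcast f) (dec x) σ D := by
  classical
  by_contra! hno
  obtain ⟨a, b, hab⟩ := exists_pair_ne V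
  let τ (c : Set (ZMod (D + 1))) (p : P) : GraphSeq P :=
    GraphSeq.splice (fun _ => CommGraph.ring f c) D (.deaf p)
  have hτ {c : Set (ZMod (D + 1))} (hc : c = ∅ ∨ ∃ k, c = {k}) (p : P) :
      τ c p ∈ ringThenBroadcast f := ring_splice_mem hc (deaf_mem_broadcastGraphs p)
  -- Without bivalence at `D`, the value depends only on `x` and `c`, so the process that is deaf
  -- afterwards can be chosen freely.
  have hmove (x : P → V) {c : Set (ZMod (D + 1))} (hc : c = ∅ ∨ ∃ k, c = {k}) (p q : P) :
      dec x (τ c p) = dec x (τ c q) :=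
    eq_of_not_bivalent (hno x _ (hτ hc p)) (hτ hc p) (hτ hc q) (fun _ _ => rfl) fun i hi => by
      simp only [τ, GraphSeq.splice_of_lt _ _ hi]
  have hcut (x : P → V) (k : ZMod (D + 1)) (p q : P) :
      dec x (τ ∅ p) = dec x (τ {k} q) := by
    rw [hmove x (.inl rfl) p (f (k + D)), hmove x (.inr ⟨k, rfl⟩) q (f (k + D))]
    exact hdec.eq_of_config_eq (hτ (.inl rfl) _) (hτ (.inr ⟨k, rfl⟩) _) (f (k + D)) D
      (A.config_splice_deaf_eq (A.config_ring_cut_eq hf x k))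
  have hsource {x x' : P → V} (k : ZMod (D + 1)) (hx : x (f k) = x' (f k)) :
      dec x (τ {k} (f k)) = dec x' (τ {k} (f k)) :=
    hdec.eq_of_config_eq (hτ (.inr ⟨k, rfl⟩) _) (hτ (.inr ⟨k, rfl⟩) _) (f k) D
      (A.config_splice_deaf_eq (A.config_ring_source_eq hf k hx D))
  have hval (v : V) (k : ZMod (D + 1)) : dec (fun _ => v) (τ {k} (f k)) = v := by
    have hm := hτ (.inr ⟨k, rfl⟩) (f k)
    obtain ⟨r, hr⟩ := hdec (fun _ => v) _ hm (f k)
    obtain ⟨_, h⟩ := hA.validity _ _ hm (f k) r _ (hr r le_rfl)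
    exact h.symm
  have h01 : (1 : ZMod (D + 1)) ≠ 0 := by simpa using ZMod.natCast_succ_ne_zero (m := 0) hD
  let x : P → V := Function.update (fun _ => b) (f 0) a
  apply hab
  calc a = dec (fun _ => a) (τ {0} (f 0)) := (hval a 0).symm
    _ = dec x (τ {0} (f 0)) := hsource 0 (by simp [x])
    _ = dec x (τ ∅ (f 0)) := (hcut x 0 _ _).symm
    _ = dec x (τ {1} (f 1)) := hcut x 1 _ _
    _ = dec (fun _ => b) (τ {1} (f 1)) := hsource 1 (by simp [x, hf.eq_iff, h01])
    _ = b := hval b 1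

/-- A bivalent execution can be prolonged by one round to a bivalent one. -/
theorem Bivalent.exists_succ [Nontrivial P] {dec : (P → V) → GraphSeq P → V}
    (hdec : A.DecisionFunction (ringThenBroadcast f) dec) {x : P → V} {σ : GraphSeq P} {r : ℕ}
    (hr : D ≤ r) (h : Bivalent (ringThenBroadcast f) (dec x) σ r) :
    ∃ σ' ∈ ringThenBroadcast f, (∀ i < r, σ' i = σ i) ∧
      Bivalent (ringThenBroadcast f) (dec x) σ' (r + 1) := by
  by_contra! hno
  obtain ⟨τ₁, h₁, τ₂, h₂, e₁, e₂, hne⟩ := h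
  let ρ (G H : CommGraph P) : GraphSeq P := (τ₁.splice r G).splice (r + 1) H
  have hρ {G H : CommGraph P} (hG : G ∈ broadcastGraphs P) (hH : H ∈ broadcastGraphs P) :
      ρ G H ∈ ringThenBroadcast f :=
    splice_mem_ringThenBroadcast (splice_mem_ringThenBroadcast h₁ hr hG) (by omega) hH
  have hρlt (G H : CommGraph P) {i : ℕ} (hi : i < r) : ρ G H i = σ i := by
    simp only [ρ]
    rw [GraphSeq.splice_of_lt _ _ (by omega), GraphSeq.splice_of_lt _ _ hi, e₁ i hi]
  have hρr (G H : CommGraph P) : ρ G H r = G := by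
    simp only [ρ]
    rw [GraphSeq.splice_of_lt _ _ (by omega), GraphSeq.splice_of_le _ _ le_rfl]
  have hmove {G H : CommGraph P} (hG : G ∈ broadcastGraphs P) (hH : H ∈ broadcastGraphs P)
      {τ : GraphSeq P} (hτ : τ ∈ ringThenBroadcast f) (hi : ∀ i < r, τ i = σ i) (hG' : τ r = G) :
      dec x τ = dec x (ρ G H) := by
    refine eq_of_not_bivalent (hno τ hτ hi) hτ (hρ hG hH) (fun _ _ => rfl) fun i hir => ?_
    rcases Nat.lt_succ_iff_lt_or_eq.mp hir with h | rfl
    · rw [hρlt _ _ h, hi i h]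
    · rw [hρr, hG']
  have hK := complete_mem_broadcastGraphs (P := P)
  have hall {τ : GraphSeq P} (hτ : τ ∈ ringThenBroadcast f) (hi : ∀ i < r, τ i = σ i) :
      dec x τ = dec x (ρ (.complete P) (.complete P)) := by
    have hG := hτ.2 r hr
    generalize hGdef : τ r = G at hG
    obtain rfl | ⟨p, rfl⟩ := hG
    · exact hmove hK hK hτ hi hGdef
    · obtain ⟨q, hq⟩ := exists_ne p
      have hp := deaf_mem_broadcastGraphs p
      have hq' := deaf_mem_broadcastGraphs q
      calc dec x τ = dec x (ρ (.deaf p) (.deaf q)) := hmove hp hq' hτ hi hGdef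
        _ = dec x (ρ (.complete P) (.deaf q)) := by
          refine hdec.eq_of_config_eq (hρ hp hq') (hρ hK hq') q (r + 1)
            (A.config_splice_deaf_eq ?_)
          -- All states agree at time `r`; at `r + 1` only `q` is tracked, which hears everybody in
          -- both executions because `q ≠ p`.
          refine A.config_eq_of_unaffected (fun s => {p | s = r + 1 → p = q}) (a := r)
            (b := r + 1) (fun p _ => ?_) ?_ (r + 1) (by omega) le_rfl q fun _ => rfl
          · rw [A.config_congr fun i hi => (τ₁.splice_of_lt _ hi).trans
              (τ₁.splice_of_lt (.complete P) hi).symm]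
          · intro s hs hs' p' hp' q'
            obtain rfl : s = r := by omega
            obtain rfl : p' = q := hp' rfl
            rw [GraphSeq.splice_of_le _ _ le_rfl, GraphSeq.splice_of_le _ _ le_rfl]
            exact ⟨⟨fun _ => trivial, fun _ h => absurd h hq⟩, fun _ h => by omega⟩
        _ = dec x (ρ (.complete P) (.complete P)) :=
          hmove hK hK (hρ hK hq') (fun i hi => hρlt _ _ hi) (hρr _ _)
  exact hne ((hall h₁ e₁).trans (hall h₂ e₂).symm)

/-- The subadversary is closed under limits of prefixes, so a sequence bivalent at every time is
admissible; a decision at a finite time would make its prefix univalent. -/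
theorem not_solvesConsensus_ringThenBroadcast [Nontrivial P] [Nontrivial V] (hD : 1 ≤ D)
    (hf : Function.Injective f) : ¬ A.SolvesConsensus (ringThenBroadcast f) := by
  intro hA
  obtain ⟨dec, hdec⟩ := hA.exists_decisionFunction
  obtain ⟨x, σ₀, hσ₀, hbiv₀⟩ := exists_bivalent_initial hD hf hA hdec
  have step (m : ℕ) (s : {σ // σ ∈ ringThenBroadcast f ∧
      Bivalent (ringThenBroadcast f) (dec x) σ (D + m)}) :
      ∃ s' : {σ // σ ∈ ringThenBroadcast f ∧
        Bivalent (ringThenBroadcast f) (dec x) σ (D + (m + 1))}, ∀ i < D + m, s'.1 i = s.1 i := by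
    obtain ⟨σ', h, hi, hb⟩ := s.2.2.exists_succ hdec (Nat.le_add_right D m)
    exact ⟨⟨σ', h, hb⟩, hi⟩
  choose next hnext using step
  let S : ∀ m, {σ // σ ∈ ringThenBroadcast f ∧
      Bivalent (ringThenBroadcast f) (dec x) σ (D + m)} :=
    fun m => Nat.rec ⟨σ₀, hσ₀, hbiv₀⟩ next m
  have hS (m k : ℕ) : ∀ i < D + m, (S (m + k)).1 i = (S m).1 i := by
    induction k with
    | zero => exact fun _ _ => rfl
    | succ k ih => exact fun i hi => (hnext (m + k) (S (m + k)) i (by omega)).trans (ih i hi)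
  -- Diagonal limit: index `i` no longer changes from stage `i + 1` on.
  let σ : GraphSeq P := fun i => (S (i + 1)).1 i
  have hσS (m i : ℕ) (hi : i < D + m) : σ i = (S m).1 i := by
    rcases le_total m (i + 1) with h | h
    · obtain ⟨k, hk⟩ := Nat.exists_eq_add_of_le h
      have := hS m k i hi
      rwa [← hk] at this
    · obtain ⟨k, rfl⟩ := Nat.exists_eq_add_of_le h
      exact (hS (i + 1) k i (by omega)).symm
  have hσ : σ ∈ ringThenBroadcast f := by
    obtain ⟨c, hc, hring⟩ := hσ₀.1
    refine ⟨⟨c, hc, fun i hi => ?_⟩, fun i hi => (S (i + 1)).2.1.2 i hi⟩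
    rw [hσS 0 i hi]
    exact hring i hi
  obtain ⟨r, hr⟩ := hdec x σ hσ (f 0)
  obtain ⟨τ, hτ, τ', hτ', e, e', hne⟩ := (S r).2.2
  have hdet {τ : GraphSeq P} (hτ : τ ∈ ringThenBroadcast f)
      (e : ∀ i < D + r, τ i = (S r).1 i) : dec x τ = dec x σ := by
    have h₁ := hr (D + r) (by omega)
    rw [Algorithm.decision, A.config_congr fun i hi => (hσS r i hi).trans (e i hi).symm] at h₁
    obtain ⟨s, hs⟩ := hdec x τ hτ (f 0)
    exact hA.agreement x τ hτ (f 0) (f 0) s (D + r) _ _ (hs s le_rfl) h₁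
  exact hne ((hdet hτ e).trans (hdet hτ' e').symm)

end Consensus

end DynNet

theorem mainTheorem2 {P : Type*} [Fintype P] {V : Type*} [Nontrivial V]
    (D x : ℕ) (hx : 1 ≤ x) (hxD : x ≤ D) (hD : D < Fintype.card P) :
    (¬ ∃ A : DynNet.Algorithm P V, A.SolvesConsensus (DynNet.eventualSTABLE P D x)) ∧
    (¬ ∃ A : DynNet.Algorithm P V,
      A.SolvesConsensus (DynNet.eventualSTABLE P D x ∩ DynNet.initiallyRooted P D)) := by
  have hD1 : 1 ≤ D := hx.trans hxD
  have : Nontrivial P := Fintype.one_lt_card_iff_nontrivial.mp (by omega)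
  -- The bound `D ≤ n - 1` leaves room for a ring of `D + 1` processes.
  obtain ⟨f⟩ : Nonempty (ZMod (D + 1) ↪ P) :=
    Function.Embedding.nonempty_of_card_le (by rw [ZMod.card]; omega)
  have hsub := DynNet.ringThenBroadcast_subset (x := x) hD1 hxD f.injective
  constructor
  · rintro ⟨A, hA⟩
    exact DynNet.not_solvesConsensus_ringThenBroadcast hD1 f.injective
      (hA.mono (hsub.trans Set.inter_subset_left))
  · rintro ⟨A, hA⟩
    exact DynNet.not_solvesConsensus_ringThenBroadcast hD1 f.injective (hA.mono hsub)
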